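/- There are absolute constants $c, C > 0$ such that the following hold, where for a finite set $A\subset\mathbb{R}$ we write $A(A+A+A+A)=\{a(b_1+b_2+b_3+b_4) : a,b_1,b_2,b_3,b_4\in A\}$. (i) For every finite set $A\subset\mathbb{R}$ with $|A|\ge 2$, $$|A(A+A+A+A)|\ \ge\ c\,\frac{|A|^2}{\log_2|A|}.$$ (ii) This is optimal up to constant and logarithmic factors: for every integer $n\ge 0$ and all real $a$ and $d\neq 0$, the arithmetic progression $A=\{a+id : 0\le i\le n-1\}$ has $|A|=n$ and satisfies $$|A(A+A+A+A)|\ \le\ C\,|A|^2 .$$ -/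

import Mathlib

open scoped Pointwise

section

open Finset

/-! ### Cauchy–Schwarz for collision counts. -/

section Collisions

variable {α β γ : Type*} [DecidableEq β] [DecidableEq γ]

/-! Let `A` be positive and `B = A + A`. By Cauchy–Schwarz, `(#A * #B ^ 2) ^ 2` is at most `#(A * (A
+ A + A + A))` times the number of solutions of `a(b + c) = a'(b' + c')` with `a, a'` in `A` and the
rest in `B`. Group these by the ratio `t = a / a'`: each `t` contributes its multiplicity in `A / A`
times at most the number of pairs in `B × B` collinear in direction `t`. For ratios of multiplicity
about `k`, Solymosi's bound leaves `O(#B ^ 2 / k ^ 2)` slopes, and cutting the grid into boxes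
bounds their total contribution by `O(#B ^ 4)`. Summing over dyadic `k` costs the logarithm, and `#B
^ 4` cancels. -/

theorem card_filter_eq_eq_sum_mul (P : Finset α) (f h : α → β) (S : Finset β)
    (hf : ∀ p ∈ P, f p ∈ S) :
    #{x ∈ P ×ˢ P | f x.1 = h x.2} = ∑ b ∈ S, #{p ∈ P | f p = b} * #{p ∈ P | h p = b} := by
  rw [card_eq_sum_card_fiberwise (f := fun x : α × α => f x.1) (t := S)]
  · refine sum_congr rfl fun b _ => ?_
    rw [← card_product]
    congr 1
    ext ⟨p, q⟩
    simp only [mem_filter, mem_product]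
    grind
  · intro x hx
    simp only [coe_filter, mem_product, Set.mem_ofPred_eq] at hx
    exact hf _ hx.1.1

/-- Cauchy–Schwarz: refining a partition into at most `#K` parts per class loses at most a factor
`#K` in the number of pairs of equivalent points. -/
theorem card_filter_eq_le_card_mul (P : Finset α) (f : α → β) (g : α → γ) (K : Finset γ)
    (hg : ∀ p ∈ P, g p ∈ K) :
    #{x ∈ P ×ˢ P | f x.1 = f x.2} ≤
      #K * #{x ∈ P ×ˢ P | f x.1 = f x.2 ∧ g x.1 = g x.2} := by
  have h1 := card_filter_eq_eq_sum_mul P f f (P.image f) fun p hp => mem_image_of_mem f hp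
  have h2 := card_filter_eq_eq_sum_mul P (fun p => (f p, g p)) (fun p => (f p, g p))
    (P.image f ×ˢ K) fun p hp => mk_mem_product (mem_image_of_mem f hp) (hg p hp)
  simp only [Prod.mk.injEq, sum_product] at h2
  rw [h1, h2, mul_sum]
  refine sum_le_sum fun b _ => ?_
  have h3 : #{p ∈ P | f p = b} = ∑ k ∈ K, #{p ∈ P | f p = b ∧ g p = k} := by
    rw [card_eq_sum_card_fiberwise (f := g) (t := K)]
    · simp only [filter_filter]
    · intro p hp
      simp only [coe_filter, Set.mem_ofPred_eq] at hp
      exact hg p hp.1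
  rw [h3, ← sq]
  simp only [← sq]
  exact sq_sum_le_card_mul_sum_sq

theorem sq_card_le_card_mul_card_filter_eq (P : Finset α) (g : α → γ) (K : Finset γ)
    (hg : ∀ p ∈ P, g p ∈ K) : #P ^ 2 ≤ #K * #{x ∈ P ×ˢ P | g x.1 = g x.2} := by
  have h := card_filter_eq_le_card_mul P (fun _ => ()) g K hg
  simpa [sq] using h

/-- AM–GM on the fibre sizes over `b` and `-b`. -/
theorem card_filter_eq_neg_le (P : Finset α) (f : α → ℝ) :
    #{x ∈ P ×ˢ P | f x.1 = -f x.2} ≤ #{x ∈ P ×ˢ P | f x.1 = f x.2} := by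
  set S := P.image f ∪ P.image fun p => -f p
  have hS : ∀ p ∈ P, f p ∈ S := fun p hp => mem_union_left _ (mem_image_of_mem f hp)
  have hS' : ∀ p ∈ P, -f p ∈ S := fun p hp =>
    mem_union_right _ (mem_image_of_mem (fun p => -f p) hp)
  have h1 := card_filter_eq_eq_sum_mul P f (fun p => -f p) S hS
  have h2 := card_filter_eq_eq_sum_mul P f f S hS
  have h3 := card_filter_eq_eq_sum_mul P (fun p => -f p) (fun p => -f p) S hS'
  simp only [neg_inj] at h3
  have h4 : 2 * #{x ∈ P ×ˢ P | f x.1 = -f x.2} ≤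
      #{x ∈ P ×ˢ P | f x.1 = f x.2} + #{x ∈ P ×ˢ P | f x.1 = f x.2} := by
    nth_rewrite 2 [h2]
    rw [h1, h3, mul_sum, ← sum_add_distrib]
    refine sum_le_sum fun b _ => ?_
    have := two_mul_le_add_sq #{p ∈ P | f p = b} #{p ∈ P | -f p = b}
    linarith
  omega

end Collisions

/-! ### Solymosi's argument on rich slopes. -/

section Slopes

/-- Sums of points of `A × A` on two neighbouring lines through the origin are distinct and lie
strictly between the lines, so each consecutive pair of slopes yields `k ^ 2` new points. -/
theorem card_sub_one_mul_sq_le_card_filter (A : Finset ℝ) (hA : ∀ a ∈ A, 0 < a) (k : ℕ)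
    (T : Finset ℝ) (hT : ∀ t ∈ T, k ≤ #{x ∈ A | t * x ∈ A}) (M : ℝ) (hM : ∀ t ∈ T, t ≤ M) :
    (#T - 1) * k ^ 2 ≤ #{z ∈ (A + A) ×ˢ (A + A) | z.2 < M * z.1} := by
  induction T using Finset.induction_on_max generalizing M with
  | empty => simp
  | insert t T hlt ih =>
    rcases T.eq_empty_or_nonempty with rfl | hne
    · simp
    set s := T.max' hne
    have hs : s ∈ T := max'_mem _ _
    have hst : s < t := hlt s hs
    have htM : t ≤ M := hM t (mem_insert_self _ _)
    have ih' := ih (fun u hu => hT u (mem_insert_of_mem hu)) s fun u hu => le_max' _ _ hu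
    set Q := ({x ∈ A | s * x ∈ A} ×ˢ {x ∈ A | t * x ∈ A}).image
      fun p : ℝ × ℝ => (p.1 + p.2, s * p.1 + t * p.2)
    have hQ : k ^ 2 ≤ #Q := by
      rw [card_image_of_injective, card_product, sq]
      · exact Nat.mul_le_mul (hT s (mem_insert_of_mem hs)) (hT t (mem_insert_self _ _))
      · rintro ⟨a, b⟩ ⟨c, d⟩ h
        simp only [Prod.mk.injEq] at h
        have h3 : (t - s) * (b - d) = 0 := by linear_combination h.2 - s * h.1
        rcases mul_eq_zero.1 h3 with h4 | h4
        · linarith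
        · ext <;> simp only <;> linarith [h.1]
    have hmem : ∀ z ∈ Q, z ∈ (A + A) ×ˢ (A + A) ∧ s * z.1 < z.2 ∧ z.2 < M * z.1 := by
      intro z hz
      simp only [Q, mem_image, mem_product, mem_filter] at hz
      obtain ⟨p, ⟨⟨h1, h2⟩, h3, h4⟩, rfl⟩ := hz
      have := hA _ h1
      have := hA _ h3
      refine ⟨mk_mem_product (add_mem_add h1 h3) (add_mem_add h2 h4), ?_, ?_⟩ <;>
        simp only <;> nlinarith
    have hdisj : Disjoint Q {z ∈ (A + A) ×ˢ (A + A) | z.2 < s * z.1} := by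
      rw [disjoint_left]
      intro z hz hz'
      exact lt_asymm (hmem z hz).2.1 (mem_filter.1 hz').2
    have hsub : Q ∪ {z ∈ (A + A) ×ˢ (A + A) | z.2 < s * z.1} ⊆
        {z ∈ (A + A) ×ˢ (A + A) | z.2 < M * z.1} := by
      refine union_subset (fun z hz => mem_filter.2 ⟨(hmem z hz).1, (hmem z hz).2.2⟩)
        fun z hz => ?_
      obtain ⟨hz1, hz2⟩ := mem_filter.1 hz
      refine mem_filter.2 ⟨hz1, hz2.trans_le ?_⟩
      obtain ⟨x, hx, y, hy, hxy⟩ := mem_add.1 (mem_product.1 hz1).1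
      have := hA x hx
      have := hA y hy
      exact mul_le_mul_of_nonneg_right (by linarith) (by linarith)
    have hcard := card_le_card hsub
    rw [card_union_of_disjoint hdisj] at hcard
    rw [card_insert_of_notMem fun h => lt_irrefl _ (hlt t h)]
    obtain ⟨m, hm⟩ := Nat.exists_eq_add_of_le (card_pos.2 hne)
    rw [hm] at ih' ⊢
    simp only [Nat.succ_eq_add_one, zero_add, Nat.add_sub_cancel_left, Nat.add_sub_cancel]
      at ih' ⊢
    nlinarith

/-- Solymosi's bound on the number of lines through the origin that are rich in `A × A`. -/
theorem card_mul_sq_le_two_mul_card_add_sq (A : Finset ℝ) (hA : ∀ a ∈ A, 0 < a) (k : ℕ)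
    (T : Finset ℝ) (hT : ∀ t ∈ T, k ≤ #{x ∈ A | t * x ∈ A}) :
    #T * k ^ 2 ≤ 2 * #(A + A) ^ 2 := by
  rcases T.eq_empty_or_nonempty with rfl | ⟨t, ht⟩
  · simp
  have h1 := (card_sub_one_mul_sq_le_card_filter A hA k T hT (T.max' ⟨t, ht⟩)
    fun u hu => le_max' _ _ hu).trans (card_filter_le _ _)
  have hk : k ≤ #(A + A) := by
    have hkA : k ≤ #A := (hT t ht).trans (card_filter_le _ _)
    rcases A.eq_empty_or_nonempty with rfl | hne
    · simpa using hkA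
    · exact hkA.trans (card_le_card_add_right hne)
  rw [card_product] at h1
  have h2 : k ^ 2 ≤ #(A + A) ^ 2 := Nat.pow_le_pow_left hk 2
  obtain ⟨m, hm⟩ := Nat.exists_eq_add_of_le (card_pos.2 ⟨t, ht⟩)
  rw [hm] at h1 ⊢
  simp only [Nat.succ_eq_add_one, zero_add, Nat.add_sub_cancel_left] at h1 ⊢
  nlinarith

end Slopes

/-! ### Collinear pairs in a grid. -/

section Grid

/-- A finite set of reals splits into consecutive blocks of at most `m` elements. -/
theorem exists_monotoneOn_block (B : Finset ℝ) (m : ℕ) (hm : 0 < m) :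
    ∃ i : ℝ → ℕ, MonotoneOn i B ∧ (∀ b ∈ B, i b < #B / m + 1) ∧
      ∀ b ∈ B, #{x ∈ B | i x = i b} ≤ m := by
  set r : ℝ → ℕ := fun b => #{x ∈ B | x < b}
  have hmono : Monotone r := fun a b hab =>
    card_le_card fun x hx => mem_filter.2 ⟨(mem_filter.1 hx).1, (mem_filter.1 hx).2.trans_le hab⟩
  have hstrict : ∀ a ∈ B, ∀ b, a < b → r a < r b := by
    intro a ha b hab
    refine card_lt_card ⟨fun x hx => mem_filter.2
      ⟨(mem_filter.1 hx).1, (mem_filter.1 hx).2.trans hab⟩, fun h => ?_⟩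
    exact lt_irrefl a (mem_filter.1 (h (mem_filter.2 ⟨ha, hab⟩))).2
  have hinj : Set.InjOn r B := by
    intro a ha b hb hab
    rcases lt_trichotomy a b with h | h | h
    · exact absurd hab (hstrict a ha b h).ne
    · exact h
    · exact absurd hab (hstrict b hb a h).ne'
  refine ⟨fun b => r b / m, fun a _ b _ hab => Nat.div_le_div_right (hmono hab), fun b _ =>
    Nat.lt_succ_of_le (Nat.div_le_div_right (card_filter_le _ _)), fun b _ => ?_⟩
  have h : #(({x ∈ B | r x / m = r b / m}).image r) ≤
      #(Finset.Ico (r b / m * m) (r b / m * m + m)) := by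
    refine card_le_card fun y hy => ?_
    obtain ⟨x, hx, rfl⟩ := mem_image.1 hy
    rw [Finset.mem_Ico, ← (mem_filter.1 hx).2]
    exact ⟨Nat.div_mul_le_self _ _, Nat.lt_div_mul_add hm⟩
  rwa [card_image_of_injOn (hinj.mono fun x hx => (mem_filter.1 hx).1), Nat.card_Ico,
    Nat.add_sub_cancel_left] at h

/-- A Szemerédi–Trotter type bound for pairs of points of the grid `B × B` on lines with positive
slopes in `T`, by cutting the grid into boxes. -/
theorem sum_card_collinear_le (B T : Finset ℝ) (hT : ∀ t ∈ T, 0 < t) (m : ℕ) (hm : 0 < m) :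
    ∑ t ∈ T, #{x ∈ (B ×ˢ B) ×ˢ (B ×ˢ B) | x.1.2 - t * x.1.1 = x.2.2 - t * x.2.1} ≤
      2 * (#B / m + 1) * (#B ^ 2 * (#T + m ^ 2)) := by
  obtain ⟨i, hi, hiR, him⟩ := exists_monotoneOn_block B m hm
  set R := #B / m + 1
  set P := B ×ˢ B with hP
  set D : Finset ((ℝ × ℝ) × (ℝ × ℝ)) :=
    {x ∈ P ×ˢ P | i x.1.1 = i x.2.1 ∧ i x.1.2 = i x.2.2} with hD
  have hDcard : #D ≤ #B ^ 2 * m ^ 2 := by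
    have : #D ≤ ∑ p ∈ P, m ^ 2 := by
      rw [card_eq_sum_card_fiberwise (f := Prod.fst) (t := P)]
      · refine sum_le_sum fun p hp => ?_
        have hp' := mem_product.1 hp
        calc _ ≤ #(({p} : Finset (ℝ × ℝ)) ×ˢ
              ({x ∈ B | i x = i p.1} ×ˢ {x ∈ B | i x = i p.2})) := by
              refine card_le_card fun x hx => ?_
              simp only [hD, hP, mem_filter, mem_product, mem_singleton] at hx ⊢
              grind
          _ ≤ m ^ 2 := by
              rw [card_product, card_product, card_singleton, one_mul, sq]
              exact Nat.mul_le_mul (him _ hp'.1) (him _ hp'.2)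
      · intro x hx
        exact (mem_product.1 (mem_filter.1 hx).1).1
    rwa [sum_const, smul_eq_mul, hP, card_product, ← sq] at this
  have hline : ∀ t ∈ T, #{x ∈ P ×ˢ P | x.1.2 - t * x.1.1 = x.2.2 - t * x.2.1} ≤
      2 * R * #{x ∈ D | x.1.2 - t * x.1.1 = x.2.2 - t * x.2.1} := by
    intro t ht
    -- On a line of positive slope both block indices increase together, so equal index sums force
    -- the same box.
    have h := card_filter_eq_le_card_mul P (fun p => p.2 - t * p.1) (fun p => i p.1 + i p.2)
      (range (2 * R)) fun p hp => by
        have h1 := hiR _ (mem_product.1 hp).1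
        have h2 := hiR _ (mem_product.1 hp).2
        rw [mem_range]
        omega
    rw [card_range] at h
    refine h.trans (Nat.mul_le_mul_left _ (card_le_card fun x hx => ?_))
    simp only [hD, hP, mem_filter, mem_product] at hx ⊢
    obtain ⟨⟨⟨h1, h2⟩, h3, h4⟩, h5, h6⟩ := hx
    refine ⟨⟨⟨⟨h1, h2⟩, h3, h4⟩, ?_⟩, h5⟩
    have ht0 := hT t ht
    rcases le_total x.1.1 x.2.1 with hle | hle
    · have h7 : x.1.2 ≤ x.2.2 := by nlinarith
      have := hi h1 h3 hle
      have := hi h2 h4 h7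
      omega
    · have h7 : x.2.2 ≤ x.1.2 := by nlinarith
      have := hi h3 h1 hle
      have := hi h4 h2 h7
      omega
  refine (sum_le_sum hline).trans ?_
  rw [← mul_sum]
  refine Nat.mul_le_mul_left _ ?_
  have hsplit : ∀ t ∈ T, #{x ∈ D | x.1.2 - t * x.1.1 = x.2.2 - t * x.2.1} ≤
      #P + #{x ∈ D | x.1 ≠ x.2 ∧ x.1.2 - t * x.1.1 = x.2.2 - t * x.2.1} := by
    intro t _
    calc _ ≤ #(P.image (fun p => (p, p)) ∪
          {x ∈ D | x.1 ≠ x.2 ∧ x.1.2 - t * x.1.1 = x.2.2 - t * x.2.1}) := by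
          refine card_le_card fun x hx => ?_
          obtain ⟨hx1, hx2⟩ := mem_filter.1 hx
          by_cases hxx : x.1 = x.2
          · exact mem_union_left _ (mem_image.2
              ⟨x.1, (mem_product.1 (mem_filter.1 hx1).1).1, Prod.ext rfl hxx⟩)
          · exact mem_union_right _ (mem_filter.2 ⟨hx1, hxx, hx2⟩)
      _ ≤ _ := (card_union_le _ _).trans (Nat.add_le_add_right card_image_le _)
  refine (sum_le_sum hsplit).trans ?_
  rw [sum_add_distrib, sum_const, smul_eq_mul, hP, card_product, ← sq, mul_add,
    mul_comm (#T)]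
  refine Nat.add_le_add_left (le_trans ?_ hDcard) _
  -- Two distinct points determine the slope, so these sets are disjoint.
  rw [← card_biUnion]
  · exact card_le_card (biUnion_subset.2 fun t _ => filter_subset _ _)
  · intro t _ u _ htu
    simp only [Function.onFun]
    rw [disjoint_left]
    intro x hx hx'
    obtain ⟨-, hne, h1⟩ := mem_filter.1 hx
    obtain ⟨-, -, h2⟩ := mem_filter.1 hx'
    have h3 : (t - u) * (x.1.1 - x.2.1) = 0 := by linear_combination h2 - h1
    rcases mul_eq_zero.1 h3 with h4 | h4
    · exact htu (sub_eq_zero.1 h4)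
    · refine hne (Prod.ext (sub_eq_zero.1 h4) ?_)
      linear_combination h1 + t * h4

end Grid

/-! ### The lower bound. -/

section ProductSet

theorem sum_card_mul_card_collinear_le (A : Finset ℝ) (hA : ∀ a ∈ A, 0 < a) (j : ℕ)
    (T : Finset ℝ) (hT : ∀ t ∈ T, 0 < t) (hlow : ∀ t ∈ T, 2 ^ j ≤ #{x ∈ A | t * x ∈ A})
    (hupp : ∀ t ∈ T, #{x ∈ A | t * x ∈ A} ≤ 2 * 2 ^ j) :
    ∑ t ∈ T, #{x ∈ A | t * x ∈ A} * #{x ∈ ((A + A) ×ˢ (A + A)) ×ˢ ((A + A) ×ˢ (A + A)) |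
      x.1.2 - t * x.1.1 = x.2.2 - t * x.2.1} ≤ 48 * #(A + A) ^ 4 := by
  rcases T.eq_empty_or_nonempty with rfl | ⟨t, ht⟩
  · simp
  have hsol := card_mul_sq_le_two_mul_card_add_sq A hA (2 ^ j) T hlow
  have hkn : 2 ^ j ≤ #(A + A) := by
    have hkA : 2 ^ j ≤ #A := (hlow t ht).trans (card_filter_le _ _)
    exact hkA.trans (card_le_card_add_right
      (card_pos.1 ((Nat.two_pow_pos j).trans_le hkA)))
  have hk : 0 < 2 ^ j := Nat.two_pow_pos j
  generalize 2 ^ j = k at *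
  set n := #(A + A) with hn
  -- This size balances the two terms: `(m * k) ^ 2` and `#T * k ^ 2` are both `O(n ^ 2)`.
  set m := n / k + 1 with hm
  have hgrid := sum_card_collinear_le (A + A) T hT m (Nat.succ_pos _)
  rw [← hn] at hgrid
  have hmk : m * k ≤ 2 * n := by
    have := Nat.div_mul_le_self n k
    rw [hm, add_mul, one_mul]
    omega
  have hR : n / m + 1 ≤ 2 * k := by
    have h1 : n < k * m := Nat.lt_mul_div_succ n hk
    have h2 : n / m < k := Nat.div_lt_of_lt_mul (by rwa [mul_comm])
    omega
  calc _ ≤ ∑ t ∈ T, 2 * k * #{x ∈ ((A + A) ×ˢ (A + A)) ×ˢ ((A + A) ×ˢ (A + A)) |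
          x.1.2 - t * x.1.1 = x.2.2 - t * x.2.1} :=
        sum_le_sum fun t ht => Nat.mul_le_mul_right _ (hupp t ht)
    _ ≤ 2 * k * (2 * (2 * k) * (n ^ 2 * (#T + m ^ 2))) := by
        rw [← mul_sum]
        exact Nat.mul_le_mul_left _ (hgrid.trans (by gcongr))
    _ = 8 * n ^ 2 * (#T * k ^ 2 + (m * k) ^ 2) := by ring
    _ ≤ 8 * n ^ 2 * (2 * n ^ 2 + (2 * n) ^ 2) := by gcongr
    _ = 48 * n ^ 4 := by ring

theorem card_mul_add_collisions_le (A B T : Finset ℝ) (hA : ∀ a ∈ A, 0 < a)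
    (hT : ∀ a ∈ A, ∀ b ∈ A, a / b ∈ T) :
    #{x ∈ (A ×ˢ (B ×ˢ B)) ×ˢ (A ×ˢ (B ×ˢ B)) |
      x.1.1 * (x.1.2.1 + x.1.2.2) = x.2.1 * (x.2.2.1 + x.2.2.2)} ≤
    ∑ t ∈ T, #{x ∈ A | t * x ∈ A} *
      #{x ∈ (B ×ˢ B) ×ˢ (B ×ˢ B) | x.1.2 - t * x.1.1 = x.2.2 - t * x.2.1} := by
  rw [card_eq_sum_card_fiberwise (f := fun x => x.1.1 / x.2.1) (t := T)]
  · refine sum_le_sum fun t _ => ?_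
    refine le_trans ?_ (Nat.mul_le_mul_left _
      (card_filter_eq_neg_le (B ×ˢ B) fun p => p.2 - t * p.1))
    rw [← card_product]
    refine card_le_card_of_injOn
      (fun x => (x.2.1, ((x.1.2.1, x.2.2.1), (x.1.2.2, x.2.2.2)))) ?_ ?_
    · rintro ⟨⟨a, b, c⟩, a', b', c'⟩ hx
      simp only [coe_filter, mem_filter, mem_product, Set.mem_ofPred_eq] at hx
      obtain ⟨⟨⟨⟨ha, hb, hc⟩, ha', hb', hc'⟩, h⟩, hat⟩ := hx
      have h0 := (hA a' ha').ne'
      have hta : t * a' = a := by rw [← hat]; field_simp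
      simp only [mem_coe, mem_product, mem_filter]
      refine ⟨⟨ha', hta ▸ ha⟩, ⟨⟨hb, hb'⟩, hc, hc'⟩, ?_⟩
      apply mul_left_cancel₀ h0
      linear_combination (-1 : ℝ) * h - (b + c) * hta
    · rintro ⟨⟨a, b, c⟩, a', b', c'⟩ hx ⟨⟨d, e, f⟩, d', e', f'⟩ hy hxy
      simp only [coe_filter, mem_filter, mem_product, Set.mem_ofPred_eq] at hx hy
      simp only [Prod.mk.injEq] at hxy
      obtain ⟨rfl, ⟨rfl, rfl⟩, rfl, rfl⟩ := hxy
      have h0 := (hA a' hx.1.1.2.1).ne'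
      have had : a = d := by
        have := hx.2.trans hy.2.symm
        exact (div_left_inj' h0).1 this
      rw [had]
  · intro x hx
    simp only [coe_filter, mem_product, Set.mem_ofPred_eq] at hx
    exact hT _ hx.1.1.1 _ hx.1.2.1

theorem card_sq_le_of_pos (A : Finset ℝ) (hA : ∀ a ∈ A, 0 < a) :
    #A ^ 2 ≤ 48 * (Nat.log 2 #A + 1) * #(A * (A + A + A + A)) := by
  rcases A.eq_empty_or_nonempty with rfl | hne
  · simp
  set B := A + A with hB
  set T := A / A
  have hTpos : ∀ t ∈ T, 0 < t := by
    intro t ht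
    obtain ⟨a, ha, b, hb, rfl⟩ := mem_div.1 ht
    exact div_pos (hA a ha) (hA b hb)
  have hw : ∀ t ∈ T, #{x ∈ A | t * x ∈ A} ≠ 0 := by
    intro t ht
    obtain ⟨a, ha, b, hb, rfl⟩ := mem_div.1 ht
    refine (card_pos.2 ⟨b, mem_filter.2 ⟨hb, ?_⟩⟩).ne'
    rwa [div_mul_cancel₀ _ (hA b hb).ne']
  have hcs := sq_card_le_card_mul_card_filter_eq (A ×ˢ (B ×ˢ B))
    (fun p => p.1 * (p.2.1 + p.2.2)) (A * (A + A + A + A)) fun p hp => by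
      simp only [mem_product] at hp
      rw [add_assoc (A + A)]
      exact mul_mem_mul hp.1 (add_mem_add hp.2.1 hp.2.2)
  have hN := card_mul_add_collisions_le A B T hA fun a ha b hb => div_mem_div ha hb
  have hlev : ∑ t ∈ T, #{x ∈ A | t * x ∈ A} *
      #{x ∈ (B ×ˢ B) ×ˢ (B ×ˢ B) | x.1.2 - t * x.1.1 = x.2.2 - t * x.2.1} ≤
      (Nat.log 2 #A + 1) * (48 * #B ^ 4) := by
    rw [← sum_fiberwise_of_maps_to (g := fun t => Nat.log 2 #{x ∈ A | t * x ∈ A})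
      (t := range (Nat.log 2 #A + 1)) fun t _ => mem_range.2 (Nat.lt_succ_of_le
        (Nat.log_mono_right (card_filter_le _ _)))]
    refine (sum_le_card_nsmul _ _ (48 * #B ^ 4) fun j _ => ?_).trans
      (by rw [card_range, smul_eq_mul])
    refine sum_card_mul_card_collinear_le A hA j _ ?_ ?_ ?_
    · exact fun t ht => hTpos t (mem_filter.1 ht).1
    · intro t ht
      obtain ⟨h1, rfl⟩ := mem_filter.1 ht
      exact Nat.pow_log_le_self 2 (hw t h1)
    · intro t ht
      obtain ⟨h1, rfl⟩ := mem_filter.1 ht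
      have := Nat.lt_pow_succ_log_self one_lt_two #{x ∈ A | t * x ∈ A}
      rw [pow_succ] at this
      omega
  have hBpos : 0 < #B ^ 4 := pow_pos (card_pos.2 (hne.add hne)) 4
  refine Nat.le_of_mul_le_mul_right ?_ hBpos
  calc #A ^ 2 * #B ^ 4 = #(A ×ˢ (B ×ˢ B)) ^ 2 := by
        rw [card_product, card_product]; ring
    _ ≤ #(A * (A + A + A + A)) * ((Nat.log 2 #A + 1) * (48 * #B ^ 4)) :=
        hcs.trans (Nat.mul_le_mul_left _ (hN.trans hlev))
    _ = _ := by ring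

theorem card_sq_le (A : Finset ℝ) (hA : 2 ≤ #A) :
    #A ^ 2 ≤ 768 * (Nat.log 2 #A + 1) * #(A * (A + A + A + A)) := by
  -- `A'` will be the positive part or the negated negative part, whichever is larger; `2 ≤ #A`
  -- absorbs a possible zero.
  have key : ∀ A' : Finset ℝ, (∀ a ∈ A', 0 < a) → #A ≤ 4 * #A' → #A' ≤ #A →
      #(A' * (A' + A' + A' + A')) ≤ #(A * (A + A + A + A)) →
      #A ^ 2 ≤ 768 * (Nat.log 2 #A + 1) * #(A * (A + A + A + A)) := by
    intro A' hpos h4 hle hcard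
    calc #A ^ 2 ≤ (4 * #A') ^ 2 := Nat.pow_le_pow_left h4 2
      _ = 16 * #A' ^ 2 := by ring
      _ ≤ 16 * (48 * (Nat.log 2 #A' + 1) * #(A' * (A' + A' + A' + A'))) :=
          Nat.mul_le_mul_left _ (card_sq_le_of_pos A' hpos)
      _ ≤ 16 * (48 * (Nat.log 2 #A + 1) * #(A * (A + A + A + A))) := by
          have := Nat.log_mono_right (b := 2) hle
          gcongr
      _ = _ := by ring
  have hsplit : #A ≤ 1 + #{a ∈ A | 0 < a} + #{a ∈ A | a < 0} := by
    calc #A ≤ #({0} ∪ {a ∈ A | 0 < a} ∪ {a ∈ A | a < 0}) := by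
          refine card_le_card fun a ha => ?_
          rcases lt_trichotomy a 0 with h | h | h <;> simp [ha, h]
      _ ≤ _ := (card_union_le _ _).trans (Nat.add_le_add_right (card_union_le _ _) _)
  rcases le_total #{a ∈ A | a < 0} #{a ∈ A | 0 < a} with h | h
  · refine key {a ∈ A | 0 < a} (fun a ha => (mem_filter.1 ha).2) (by omega)
      (card_filter_le _ _) (card_le_card ?_)
    have hs := filter_subset (fun a : ℝ => 0 < a) A
    gcongr
  · set N := {a ∈ A | a < 0}
    have hs : N ⊆ A := filter_subset _ _
    refine key (-N) ?_ (by rw [card_neg]; omega) ((card_neg _).trans_le (card_filter_le _ _))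
      (card_le_card ?_)
    · intro a ha
      have := (mem_filter.1 (mem_neg'.1 ha)).2
      linarith
    · rw [← neg_add, ← neg_add, ← neg_add, neg_mul_neg]
      gcongr

end ProductSet

/-! ### Sharpness for progressions. -/

section Progression

theorem card_progression_mul_le (n : ℕ) (a d : ℝ) (A : Finset ℝ)
    (hA : A = (range n).image fun i : ℕ => a + (i : ℝ) * d) :
    #(A * (A + A + A + A)) ≤ 4 * n ^ 2 := by
  have h1 : #A ≤ n := hA ▸ card_image_le.trans_eq (card_range n)
  have h2 : #(A + A + A + A) ≤ 4 * n := by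
    calc _ ≤ #((range (4 * n)).image fun i : ℕ => 4 * a + (i : ℝ) * d) := by
          refine card_le_card fun x hx => ?_
          simp only [hA, mem_add, mem_image, mem_range, exists_exists_and_eq_and] at hx ⊢
          obtain ⟨i, ⟨j, ⟨k, hk, l, hl, rfl⟩, p, hp, rfl⟩, q, hq, rfl⟩ := hx
          refine ⟨k + l + p + q, by omega, ?_⟩
          push_cast
          ring
      _ ≤ 4 * n := card_image_le.trans_eq (card_range _)
  calc _ ≤ #A * #(A + A + A + A) := card_mul_le
    _ ≤ n * (4 * n) := Nat.mul_le_mul h1 h2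
    _ = 4 * n ^ 2 := by ring

theorem card_progression (n : ℕ) (a d : ℝ) (hd : d ≠ 0) :
    #((range n).image fun i : ℕ => a + (i : ℝ) * d) = n := by
  rw [card_image_of_injective, card_range]
  intro i j hij
  simpa [hd] using hij

end Progression

end

theorem theorem2p5 :
    -- the lower bound, with an absolute constant and the logarithm to base 2
    (∃ c : ℝ, 0 < c ∧ ∀ A : Finset ℝ, 2 ≤ A.card →
      c * ((A.card : ℝ) ^ 2 / Real.logb 2 (A.card : ℝ)) ≤
        ((A * (A + A + A + A)).card : ℝ)) ∧
    -- optimality up to constant and logarithmic factors: every arithmetic progression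
    -- `a, a + d, …, a + (n - 1) d` satisfies the matching upper bound without the logarithm
    (∃ C : ℝ, 0 < C ∧ ∀ (n : ℕ) (a d : ℝ), d ≠ 0 →
      ∀ A : Finset ℝ, A = (Finset.range n).image (fun i : ℕ => a + (i : ℝ) * d) →
        A.card = n ∧ ((A * (A + A + A + A)).card : ℝ) ≤ C * (A.card : ℝ) ^ 2) := by
  -- `1536 = 2 * 768`, as `Nat.log 2 #A + 1` is at most twice the real logarithm.
  refine ⟨⟨1 / 1536, by norm_num, fun A hA => ?_⟩, 4, by norm_num, fun n a d hd A hA => ?_⟩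
  · have hA' : (2 : ℝ) ≤ A.card := by exact_mod_cast hA
    have hlog : 1 ≤ Real.logb 2 A.card := by
      rw [Real.le_logb_iff_rpow_le one_lt_two (by linarith)]
      simpa using hA'
    have hnat : (Nat.log 2 A.card : ℝ) ≤ Real.logb 2 A.card := by
      exact_mod_cast Real.natLog_le_logb A.card 2
    have h : (A.card : ℝ) ^ 2 ≤
        768 * (Nat.log 2 A.card + 1) * ((A * (A + A + A + A)).card : ℝ) := by
      exact_mod_cast card_sq_le A hA
    rw [← mul_div_assoc, div_le_iff₀ (by linarith)]
    have h2 : 768 * (Nat.log 2 A.card + 1) * ((A * (A + A + A + A)).card : ℝ) ≤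
        768 * (2 * Real.logb 2 A.card) * ((A * (A + A + A + A)).card : ℝ) := by
      gcongr
      linarith
    linarith
  · have hn : A.card = n := hA ▸ card_progression n a d hd
    refine ⟨hn, ?_⟩
    rw [hn]
    exact_mod_cast card_progression_mul_le n a d A hA
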